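/- Let $K$ be a field. A (multiplicative) Hom-Leibniz algebra over $K$ is a vector space $L$ with a bilinear bracket and a linear map $\alpha:L\to L$ such that $\alpha[x,y]=[\alpha x,\alpha y]$ and $[\alpha x,[y,z]]=[[x,y],\alpha z]-[[x,z],\alpha y]$. It is a Hom-Lie algebra if moreover $[x,x]=0$ for all $x$. Isomorphisms of such algebras are linear bijections that preserve the brackets and commute with the maps $\alpha$. Let $(L,\alpha)$ be a perfect Hom-Lie algebra, i.e. $L$ is spanned by its brackets. *Tensor squares.* The non-abelian Hom-Leibniz tensor square $L\ast L$ is the non-abelian Hom-Leibniz tensor product $M\ast N$ for $M=N=L$, acting on each other by the bracket (${}^xy=[x,y]$, $y^x=[y,x]$). Here $M\ast N$ is the vector space spanned by symbols $m\ast n$ and $n\ast m$ ($m\in M$, $n\in N$; two separate families), bilinear in both entries and subject to $$\begin{aligned} \alpha m\ast[n,n']&=m^n\ast\alpha n'-m^{n'}\ast\alpha n, & \alpha n\ast[m,m']&=n^m\ast\alpha m'-n^{m'}\ast\alpha m,\\ [m,m']\ast\alpha n&={}^mn\ast\alpha m'-\alpha m\ast n^{m'}, & [n,n']\ast\alpha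 m&={}^nm\ast\alpha n'-\alpha n\ast m^{n'},\\ \alpha m\ast{}^{m'}n&=-\alpha m\ast n^{m'}, & \alpha n\ast{}^{n'}m&=-\alpha n\ast m^{n'},\\ m^n\ast{}^{m'}n'&={}^mn\ast m'^{n'}, & m^n\ast n'^{m'}&={}^mn\ast{}^{n'}m',\\ {}^nm\ast{}^{m'}n'&=n^m\ast m'^{n'}, & {}^nm\ast n'^{m'}&=n^m\ast{}^{n'}m', \end{aligned}$$ with $\alpha$ acting on both entries and bracket $[m\ast n,m'\ast n']=m^n\ast{}^{m'}n'$, $[m\ast n,n'\ast m']=m^n\ast n'^{m'}$, $[n\ast m,m'\ast n']={}^nm\ast{}^{m'}n'$, $[n\ast m,n'\ast m']={}^nm\ast n'^{m'}$. The non-abelian Hom-Lie tensor square $L\star L$ is the quotient of $L\otimes L$ (with $m\star n$ the class of $m\otimes n$) by the relations $$[m,m']\star\alpha n=\alpha m\star[m',n]-\alpha m'\star[m,n],\qquad \alpha m\star[n,n']=[n',m]\star\alpha n-[n,m]\star\alpha n',$$ $$[n,m]\star[m,n]=0,\qquad [n,m]\star[m',n']=-[n',m']\star[m,n],$$ with $\alpha(m\star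 n)=\alpha m\star\alpha n$ and bracket $[m\star n,m'\star n']=-[n,m]\star[m',n']$. Let $\xi:L\ast L\to L\star L$ be the canonical epimorphism, which sends a symbol $m\ast n$ of the first family to $m\star n$ and a symbol $n\ast m$ of the second family to $-m\star n$. *Homology.* $HL_2^\alpha(L)$ is the homology at $L^{\otimes 2}$ of $L^{\otimes3}\to L^{\otimes2}\to L$, with $x\otimes y\otimes z\mapsto-[x,y]\otimes\alpha z+[x,z]\otimes\alpha y+\alpha x\otimes[y,z]$ and $x\otimes y\mapsto-[x,y]$. $H_2^\alpha(L)$ is the homology at $\Lambda^2L$ of $\Lambda^3L\to\Lambda^2L\to L$, with $x\wedge y\wedge z\mapsto-[x,y]\wedge\alpha z+[x,z]\wedge\alpha y-[y,z]\wedge\alpha x$ and $x\wedge y\mapsto-[x,y]$. Let $\pi:HL_2^\alpha(L)\to H_2^\alpha(L)$ be the canonical map induced by $x\otimes y\mapsto x\wedge y$. **Proposition 4.7.** For every perfect Hom-Lie algebra $(L,\alpha)$: 1. $L\star L$ and $L\ast L$ are isomorphic as Hom-Leibniz algebras if and only if the second homologies $H_2^\alpha(L)$ and $HL_2^\alpha(L)$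 are canonically isomorphic, i.e. $\pi$ is bijective. 2. $\xi$ is bijective if and only if $\pi$ is bijective. 3. If $H_2^\alpha(L)$ is finite-dimensional, then $L\star L$ and $L\ast L$ are isomorphic as Hom-Leibniz algebras if and only if $H_2^\alpha(L)$ and $HL_2^\alpha(L)$ are isomorphic as vector spaces. -/

import Mathlib

open scoped TensorProduct

set_option linter.unusedSimpArgs false

/-! ### Hom-Leibniz and Hom-Lie algebras -/

/-- A (multiplicative) Hom-Leibniz algebra structure on the vector space `L`. -/
structure HomLeibnizAlgebra (K L : Type*) [Field K] [AddCommGroup L] [Module K L] where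
  bracket : L →ₗ[K] L →ₗ[K] L
  twist : L →ₗ[K] L
  leibniz : ∀ x y z, bracket (twist x) (bracket y z) =
    bracket (bracket x y) (twist z) - bracket (bracket x z) (twist y)
  twist_bracket : ∀ x y, twist (bracket x y) = bracket (twist x) (twist y)

/-- A (multiplicative) Hom-Lie algebra structure on the vector space `L`. Skew-symmetry is
`[x, x] = 0`, which is `[x, y] = -[y, x]` unless the characteristic is two. -/
structure HomLieAlgebra (K L : Type*) [Field K] [AddCommGroup L] [Module K L] where
  bracket : L →ₗ[K] L →ₗ[K] L
  twist : L →ₗ[K] L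
  bracket_self : ∀ x, bracket x x = 0
  jacobi : ∀ x y z, bracket (twist x) (bracket y z) + bracket (twist z) (bracket x y)
    + bracket (twist y) (bracket z x) = 0
  twist_bracket : ∀ x y, twist (bracket x y) = bracket (twist x) (twist y)

namespace HomLeibnizAlgebra

variable {K L L' : Type*} [Field K] [AddCommGroup L] [Module K L] [AddCommGroup L'] [Module K L']

/-- Two Hom-Leibniz algebras are isomorphic if there is a linear bijection between them that
preserves the brackets and commutes with the twisting maps. -/
def Isomorphic (A : HomLeibnizAlgebra K L) (B : HomLeibnizAlgebra K L') : Prop :=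
  ∃ e : L ≃ₗ[K] L', (∀ x y, e (A.bracket x y) = B.bracket (e x) (e y)) ∧
    ∀ x, e (A.twist x) = B.twist (e x)

end HomLeibnizAlgebra

namespace HomLieAlgebra

variable {K L : Type*} [Field K] [AddCommGroup L] [Module K L] (A : HomLieAlgebra K L)

theorem bracket_skew (x y : L) : A.bracket x y = -A.bracket y x := by
  have h := A.bracket_self (x + y)
  simp only [map_add, LinearMap.add_apply, A.bracket_self, zero_add, add_zero] at h
  refine eq_neg_of_add_eq_zero_left ?_
  first
    | exact h
    | (rw [add_comm]; exact h)

/-- The inclusion of Hom-Lie algebras into Hom-Leibniz algebras. -/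
def toHomLeibniz : HomLeibnizAlgebra K L where
  bracket := A.bracket
  twist := A.twist
  leibniz x y z := by
    have h := A.jacobi x y z
    rw [A.bracket_skew (A.twist z), A.bracket_skew (A.twist y), A.bracket_skew z x] at h
    simp only [map_neg, LinearMap.neg_apply, neg_neg] at h
    have h2 : A.bracket (A.twist x) (A.bracket y z) - (A.bracket (A.bracket x y) (A.twist z) -
      A.bracket (A.bracket x z) (A.twist y)) = 0 := by rw [← h]; abel
    exact sub_eq_zero.mp h2
  twist_bracket := A.twist_bracket

/-- `L = [L, L]`, where `[L, L]` is the subspace spanned by all brackets. -/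
def IsPerfect : Prop :=
  Submodule.span K {z : L | ∃ x y, z = A.bracket x y} = ⊤

end HomLieAlgebra

/-! ### The non-abelian Hom-Leibniz tensor product -/

/-- A Hom-Leibniz action of `(L, A)` on `(M, B)`: `left x m` is `ˣm` and `right m x` is `mˣ`. -/
structure HomLeibnizAction {K L M : Type*} [Field K] [AddCommGroup L] [Module K L]
    [AddCommGroup M] [Module K M] (A : HomLeibnizAlgebra K L) (B : HomLeibnizAlgebra K M) where
  left : L →ₗ[K] M →ₗ[K] M
  right : M →ₗ[K] L →ₗ[K] M
  right_bracket : ∀ m x y, right (B.twist m) (A.bracket x y) =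
    right (right m x) (A.twist y) - right (right m y) (A.twist x)
  left_bracket : ∀ m x y, left (A.bracket x y) (B.twist m) =
    right (left x m) (A.twist y) - left (A.twist x) (right m y)
  left_left : ∀ m x y, left (A.twist x) (left y m) = -left (A.twist x) (right m y)
  left_apply_bracket : ∀ x m m', left (A.twist x) (B.bracket m m') =
    B.bracket (left x m) (B.twist m') - B.bracket (left x m') (B.twist m)
  right_apply_bracket : ∀ x m m', right (B.bracket m m') (A.twist x) =
    B.bracket (right m x) (B.twist m') + B.bracket (B.twist m) (right m' x)
  bracket_left : ∀ x m m', B.bracket (B.twist m) (left x m') =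
    -B.bracket (B.twist m) (right m' x)
  twist_left : ∀ x m, B.twist (left x m) = left (A.twist x) (B.twist m)
  twist_right : ∀ x m, B.twist (right m x) = right (B.twist m) (A.twist x)

namespace HomLeibnizAction

section

variable {K M N : Type*} [Field K] [AddCommGroup M] [Module K M] [AddCommGroup N] [Module K N]
  {A : HomLeibnizAlgebra K M} {B : HomLeibnizAlgebra K N}

/-- Compatibility of an action `a` of `M` on `N` with an action `b` of `N` on `M`. -/
structure Compatible (a : HomLeibnizAction A B) (b : HomLeibnizAction B A) : Prop where
  m_left_left : ∀ m m' n, b.left (a.left m n) m' = A.bracket (b.right m n) m'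
  m_left_right : ∀ m m' n, b.left (a.right n m) m' = A.bracket (b.left n m) m'
  m_right_left : ∀ m m' n, b.right m (a.left m' n) = A.bracket m (b.right m' n)
  m_right_right : ∀ m m' n, b.right m (a.right n m') = A.bracket m (b.left n m')
  n_left_left : ∀ n n' m, a.left (b.left n m) n' = B.bracket (a.right n m) n'
  n_left_right : ∀ n n' m, a.left (b.right m n) n' = B.bracket (a.left m n) n'
  n_right_left : ∀ n n' m, a.right n (b.left n' m) = B.bracket n (a.right n' m)
  n_right_right : ∀ n n' m, a.right n (b.right m n') = B.bracket n (a.left m n')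

/-- The defining relators of `M ∗ N` beyond bilinearity, inside `(M ⊗ N) × (N ⊗ M)`: the first
factor is spanned by the symbols `m ∗ n` and the second by the symbols `n ∗ m`. -/
inductive Relator (a : HomLeibnizAction A B) (b : HomLeibnizAction B A) :
    (M ⊗[K] N) × (N ⊗[K] M) → Prop
  | r1 (m : M) (n n' : N) : Relator a b
      (A.twist m ⊗ₜ B.bracket n n'
        - (b.right m n ⊗ₜ B.twist n' - b.right m n' ⊗ₜ B.twist n), 0)
  | r2 (n : N) (m m' : M) : Relator a b
      (0, B.twist n ⊗ₜ A.bracket m m'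
        - (a.right n m ⊗ₜ A.twist m' - a.right n m' ⊗ₜ A.twist m))
  | r3 (m m' : M) (n : N) : Relator a b
      ((A.bracket m m' ⊗ₜ B.twist n, 0)
        - ((0, a.left m n ⊗ₜ A.twist m') - (A.twist m ⊗ₜ a.right n m', 0)))
  | r4 (n n' : N) (m : M) : Relator a b
      ((0, B.bracket n n' ⊗ₜ A.twist m)
        - ((b.left n m ⊗ₜ B.twist n', 0) - (0, B.twist n ⊗ₜ b.right m n')))
  | r5 (m m' : M) (n : N) : Relator a b
      (A.twist m ⊗ₜ a.left m' n - (-(A.twist m ⊗ₜ a.right n m')), 0)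
  | r6 (n n' : N) (m : M) : Relator a b
      (0, B.twist n ⊗ₜ b.left n' m - (-(B.twist n ⊗ₜ b.right m n')))
  | r7 (m m' : M) (n n' : N) : Relator a b
      ((b.right m n ⊗ₜ a.left m' n', 0) - (0, a.left m n ⊗ₜ b.right m' n'))
  | r8 (m m' : M) (n n' : N) : Relator a b
      ((b.right m n ⊗ₜ a.right n' m', 0) - (0, a.left m n ⊗ₜ b.left n' m'))
  | r9 (m m' : M) (n n' : N) : Relator a b
      ((b.left n m ⊗ₜ a.left m' n', 0) - (0, a.right n m ⊗ₜ b.right m' n'))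
  | r10 (m m' : M) (n n' : N) : Relator a b
      ((b.left n m ⊗ₜ a.right n' m', 0) - (0, a.right n m ⊗ₜ b.left n' m'))

/-- The vector space `M ∗ N`. -/
abbrev TensorSpace (a : HomLeibnizAction A B) (b : HomLeibnizAction B A) : Type _ :=
  ((M ⊗[K] N) × (N ⊗[K] M)) ⧸ Submodule.span K {t | Relator a b t}

variable (a : HomLeibnizAction A B) (b : HomLeibnizAction B A)

/-- The bilinear map `(m, n) ↦ m ∗ n`. -/
def starMN : M →ₗ[K] N →ₗ[K] TensorSpace a b :=
  TensorProduct.curry ((Submodule.mkQ (Submodule.span K {t | Relator a b t})).comp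
    (LinearMap.inl K (M ⊗[K] N) (N ⊗[K] M)))

/-- The bilinear map `(n, m) ↦ n ∗ m`. -/
def starNM : N →ₗ[K] M →ₗ[K] TensorSpace a b :=
  TensorProduct.curry ((Submodule.mkQ (Submodule.span K {t | Relator a b t})).comp
    (LinearMap.inr K (M ⊗[K] N) (N ⊗[K] M)))

variable {a b}

theorem mk_eq_starMN (m : M) (n : N) :
    (Submodule.Quotient.mk (m ⊗ₜ n, 0) : TensorSpace a b) = starMN a b m n := rfl

theorem mk_eq_starNM (m : M) (n : N) :
    (Submodule.Quotient.mk (0, n ⊗ₜ m) : TensorSpace a b) = starNM a b n m := rfl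

/-- `M ∗ N` is spanned by the symbols `m ∗ n` and `n ∗ m`. -/
theorem tensor_induction {P : TensorSpace a b → Prop}
    (h1 : ∀ m n, P (starMN a b m n)) (h2 : ∀ n m, P (starNM a b n m))
    (h0 : P 0) (hadd : ∀ x y, P x → P y → P (x + y)) (x : TensorSpace a b) : P x := by
  obtain ⟨⟨s, t⟩, rfl⟩ := Submodule.Quotient.mk_surjective _ x
  have e : (Submodule.Quotient.mk (s, t) : TensorSpace a b) =
      Submodule.Quotient.mk (s, 0) + Submodule.Quotient.mk (0, t) := by
    rw [← Submodule.Quotient.mk_add]; simp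
  rw [e]
  apply hadd
  · induction s using TensorProduct.induction_on with
    | zero => exact h0
    | tmul m n => exact h1 m n
    | add u v hu hv =>
      have e' : (Submodule.Quotient.mk (u + v, 0) : TensorSpace a b) =
        Submodule.Quotient.mk (u, 0) + Submodule.Quotient.mk (v, 0) := by
        rw [← Submodule.Quotient.mk_add]; simp
      rw [e']
      refine hadd _ _ (hu ?_) (hv ?_) <;>
        (rw [← Submodule.Quotient.mk_add]; simp)
  · induction t using TensorProduct.induction_on with
    | zero => exact h0
    | tmul m n => exact h2 m n
    | add u v hu hv =>
      have e' : (Submodule.Quotient.mk (0, u + v) : TensorSpace a b) =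
        Submodule.Quotient.mk (0, u) + Submodule.Quotient.mk (0, v) := by
        rw [← Submodule.Quotient.mk_add]; simp
      rw [e']
      refine hadd _ _ (hu ?_) (hv ?_) <;>
        (rw [← Submodule.Quotient.mk_add]; simp)

variable (a b)

theorem rel1 (m : M) (n n' : N) : starMN a b (A.twist m) (B.bracket n n') =
    starMN a b (b.right m n) (B.twist n') - starMN a b (b.right m n') (B.twist n) := by
  have h := (Submodule.Quotient.mk_eq_zero (Submodule.span K {t | Relator a b t})).2
    (Submodule.subset_span (Relator.r1 (a := a) (b := b) m n n'))
  rw [← sub_eq_zero, ← h]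
  simp only [← mk_eq_starMN, ← Submodule.Quotient.mk_sub]
  simp

/-- Linear maps out of `M ∗ N` are given on the symbols and must kill the relators. -/
def tensorLift {V : Type*} [AddCommGroup V] [Module K V] (f : M →ₗ[K] N →ₗ[K] V)
    (g : N →ₗ[K] M →ₗ[K] V)
    (h : ∀ t, Relator a b t → (TensorProduct.lift f).coprod (TensorProduct.lift g) t = 0) :
    TensorSpace a b →ₗ[K] V :=
  Submodule.liftQ _ ((TensorProduct.lift f).coprod (TensorProduct.lift g))
    (Submodule.span_le.2 fun t ht => h t ht)

variable {a b}

@[simp] theorem tensorLift_starMN {V : Type*} [AddCommGroup V] [Module K V]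
    (f : M →ₗ[K] N →ₗ[K] V) (g : N →ₗ[K] M →ₗ[K] V) (h) (m : M) (n : N) :
    tensorLift a b f g h (starMN a b m n) = f m n := by
  rw [← mk_eq_starMN]
  simp [tensorLift]

@[simp] theorem tensorLift_starNM {V : Type*} [AddCommGroup V] [Module K V]
    (f : M →ₗ[K] N →ₗ[K] V) (g : N →ₗ[K] M →ₗ[K] V) (h) (m : M) (n : N) :
    tensorLift a b f g h (starNM a b n m) = g n m := by
  rw [← mk_eq_starNM]
  simp [tensorLift]

/-- `ψ₁(m ∗ n) = mⁿ` and `ψ₁(n ∗ m) = ⁿm`. -/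
def psi1 (c : Compatible a b) : TensorSpace a b →ₗ[K] M :=
  tensorLift a b b.right b.left (by
    intro t ht
    cases ht <;>
      simp [c.m_left_left, c.m_left_right, c.m_right_left, c.m_right_right, b.right_bracket,
        b.left_bracket, b.left_left, b.left_apply_bracket, b.right_apply_bracket, b.bracket_left])

/-- `ψ₂(m ∗ n) = ᵐn` and `ψ₂(n ∗ m) = nᵐ`. -/
def psi2 (c : Compatible a b) : TensorSpace a b →ₗ[K] N :=
  tensorLift a b a.left a.right (by
    intro t ht
    cases ht <;>
      simp [c.n_left_left, c.n_left_right, c.n_right_left, c.n_right_right, a.right_bracket,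
        a.left_bracket, a.left_left, a.left_apply_bracket, a.right_apply_bracket, a.bracket_left])

variable (a b) in
/-- The twisting map of `M ∗ N`: `m ∗ n ↦ α(m) ∗ α(n)` and `n ∗ m ↦ α(n) ∗ α(m)`. -/
def tensorTwist : TensorSpace a b →ₗ[K] TensorSpace a b :=
  Submodule.mapQ _ _
    ((TensorProduct.map A.twist B.twist).prodMap (TensorProduct.map B.twist A.twist))
    (Submodule.span_le.2 (by
      intro t ht
      refine Submodule.subset_span ?_
      have e : ∀ {s : (M ⊗[K] N) × (N ⊗[K] M)}, Relator a b s →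
        ((TensorProduct.map A.twist B.twist).prodMap (TensorProduct.map B.twist A.twist)) t = s →
        Relator a b (((TensorProduct.map A.twist B.twist).prodMap
          (TensorProduct.map B.twist A.twist)) t) := fun h h' => h' ▸ h
      cases ht with
      | r1 m n n' => exact e (.r1 (A.twist m) (B.twist n) (B.twist n')) (by
          simp [A.twist_bracket, B.twist_bracket, a.twist_left, a.twist_right, b.twist_left,
            b.twist_right])
      | r2 n m m' => exact e (.r2 (B.twist n) (A.twist m) (A.twist m')) (by
          simp [A.twist_bracket, B.twist_bracket, a.twist_left, a.twist_right, b.twist_left,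
            b.twist_right])
      | r3 m m' n => exact e (.r3 (A.twist m) (A.twist m') (B.twist n)) (by
          simp [A.twist_bracket, B.twist_bracket, a.twist_left, a.twist_right, b.twist_left,
            b.twist_right])
      | r4 n n' m => exact e (.r4 (B.twist n) (B.twist n') (A.twist m)) (by
          simp [A.twist_bracket, B.twist_bracket, a.twist_left, a.twist_right, b.twist_left,
            b.twist_right])
      | r5 m m' n => exact e (.r5 (A.twist m) (A.twist m') (B.twist n)) (by
          simp [A.twist_bracket, B.twist_bracket, a.twist_left, a.twist_right, b.twist_left,
            b.twist_right])
      | r6 n n' m => exact e (.r6 (B.twist n) (B.twist n') (A.twist m)) (by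
          simp [A.twist_bracket, B.twist_bracket, a.twist_left, a.twist_right, b.twist_left,
            b.twist_right])
      | r7 m m' n n' =>
          exact e (.r7 (A.twist m) (A.twist m') (B.twist n) (B.twist n')) (by
            simp [A.twist_bracket, B.twist_bracket, a.twist_left, a.twist_right, b.twist_left,
              b.twist_right])
      | r8 m m' n n' =>
          exact e (.r8 (A.twist m) (A.twist m') (B.twist n) (B.twist n')) (by
            simp [A.twist_bracket, B.twist_bracket, a.twist_left, a.twist_right, b.twist_left,
              b.twist_right])
      | r9 m m' n n' =>
          exact e (.r9 (A.twist m) (A.twist m') (B.twist n) (B.twist n')) (by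
            simp [A.twist_bracket, B.twist_bracket, a.twist_left, a.twist_right, b.twist_left,
              b.twist_right])
      | r10 m m' n n' =>
          exact e (.r10 (A.twist m) (A.twist m') (B.twist n) (B.twist n')) (by
            simp [A.twist_bracket, B.twist_bracket, a.twist_left, a.twist_right, b.twist_left,
              b.twist_right])))

@[simp] theorem tensorTwist_starMN (m : M) (n : N) :
    tensorTwist a b (starMN a b m n) = starMN a b (A.twist m) (B.twist n) := by
  rw [← mk_eq_starMN, ← mk_eq_starMN]
  simp [tensorTwist]

@[simp] theorem tensorTwist_starNM (m : M) (n : N) :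
    tensorTwist a b (starNM a b n m) = starNM a b (B.twist n) (A.twist m) := by
  rw [← mk_eq_starNM, ← mk_eq_starNM]
  simp [tensorTwist]

theorem psi1_tensorTwist (c : Compatible a b) (x : TensorSpace a b) :
    psi1 c (tensorTwist a b x) = A.twist (psi1 c x) := by
  induction x using tensor_induction with
  | h1 m n => simp [psi1, b.twist_right]
  | h2 n m => simp [psi1, b.twist_left]
  | h0 => simp
  | hadd x y hx hy => simp [hx, hy]

theorem psi2_tensorTwist (c : Compatible a b) (x : TensorSpace a b) :
    psi2 c (tensorTwist a b x) = B.twist (psi2 c x) := by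
  induction x using tensor_induction with
  | h1 m n => simp [psi2, a.twist_left]
  | h2 n m => simp [psi2, a.twist_right]
  | h0 => simp
  | hadd x y hx hy => simp [hx, hy]

theorem left_psi1 (c : Compatible a b) (x : TensorSpace a b) (n : N) :
    a.left (psi1 c x) n = B.bracket (psi2 c x) n := by
  induction x using tensor_induction with
  | h1 m n' => simp [psi1, psi2, c.n_left_right]
  | h2 n' m => simp [psi1, psi2, c.n_left_left]
  | h0 => simp
  | hadd x y hx hy => simp [hx, hy]

/-- The non-abelian Hom-Leibniz tensor product `M ∗ N`. Its bracket is `[x, y] = ψ₁(x) ∗ ψ₂(y)`,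
that is `[m ∗ n, m' ∗ n'] = mⁿ ∗ ᵐ'n'`, `[m ∗ n, n' ∗ m'] = mⁿ ∗ n'ᵐ'`,
`[n ∗ m, m' ∗ n'] = ⁿm ∗ ᵐ'n'` and `[n ∗ m, n' ∗ m'] = ⁿm ∗ n'ᵐ'`; see `tensor_bracket` below. -/
def tensor (c : Compatible a b) : HomLeibnizAlgebra K (TensorSpace a b) where
  bracket := (starMN a b).compl₁₂ (psi1 c) (psi2 c)
  twist := tensorTwist a b
  leibniz x y z := by
    simp only [LinearMap.compl₁₂_apply, psi1_tensorTwist, psi2_tensorTwist]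
    have h2 : psi2 c (starMN a b (psi1 c y) (psi2 c z)) =
        B.bracket (psi2 c y) (psi2 c z) := by
      rw [← left_psi1]; simp [psi2]
    have h1 : ∀ m n, psi1 c (starMN a b m n) = b.right m n := by
      intro m n; simp [psi1]
    rw [h2, h1, h1, rel1]
  twist_bracket x y := by
    simp [psi1_tensorTwist, psi2_tensorTwist]

theorem tensor_bracket (c : Compatible a b) (m m' : M) (n n' : N) :
    (tensor c).bracket (starMN a b m n) (starMN a b m' n') =
        starMN a b (b.right m n) (a.left m' n') ∧
      (tensor c).bracket (starMN a b m n) (starNM a b n' m') =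
        starMN a b (b.right m n) (a.right n' m') ∧
      (tensor c).bracket (starNM a b n m) (starMN a b m' n') =
        starMN a b (b.left n m) (a.left m' n') ∧
      (tensor c).bracket (starNM a b n m) (starNM a b n' m') =
        starMN a b (b.left n m) (a.right n' m') := by
  simp [tensor, psi1, psi2]

end

end HomLeibnizAction

/-! ### The non-abelian Hom-Lie tensor product -/

/-- A Hom-Lie action of `(L, A)` on `(M, B)`: `act x m` is `ˣm`. -/
structure HomLieAction {K L M : Type*} [Field K] [AddCommGroup L] [Module K L]
    [AddCommGroup M] [Module K M] (A : HomLieAlgebra K L) (B : HomLieAlgebra K M) where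
  act : L →ₗ[K] M →ₗ[K] M
  act_bracket : ∀ x y m, act (A.bracket x y) (B.twist m) =
    act (A.twist x) (act y m) - act (A.twist y) (act x m)
  act_apply_bracket : ∀ x m m', act (A.twist x) (B.bracket m m') =
    B.bracket (act x m) (B.twist m') + B.bracket (B.twist m) (act x m')
  twist_act : ∀ x m, B.twist (act x m) = act (A.twist x) (B.twist m)

namespace HomLieAction

section

variable {K M N : Type*} [Field K] [AddCommGroup M] [Module K M] [AddCommGroup N] [Module K N]
  {A : HomLieAlgebra K M} {B : HomLieAlgebra K N}

/-- Compatibility of an action `a` of `M` on `N` with an action `b` of `N` on `M`. -/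
structure Compatible (a : HomLieAction A B) (b : HomLieAction B A) : Prop where
  m_act : ∀ m m' n, b.act (a.act m n) m' = A.bracket m' (b.act n m)
  n_act : ∀ n n' m, a.act (b.act n m) n' = B.bracket n' (a.act m n)

/-- The defining relators of `M ⋆ N` inside `M ⊗ N`. In characteristic other than two the
relators `r3` are instances of `r4` up to a factor two. -/
inductive Relator (a : HomLieAction A B) (b : HomLieAction B A) : M ⊗[K] N → Prop
  | r1 (m m' : M) (n : N) : Relator a b
      (A.bracket m m' ⊗ₜ B.twist n - (A.twist m ⊗ₜ a.act m' n - A.twist m' ⊗ₜ a.act m n))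
  | r2 (m : M) (n n' : N) : Relator a b
      (A.twist m ⊗ₜ B.bracket n n' - (b.act n' m ⊗ₜ B.twist n - b.act n m ⊗ₜ B.twist n'))
  | r3 (m : M) (n : N) : Relator a b (b.act n m ⊗ₜ a.act m n)
  | r4 (m m' : M) (n n' : N) : Relator a b
      (b.act n m ⊗ₜ a.act m' n' + b.act n' m' ⊗ₜ a.act m n)

/-- The vector space `M ⋆ N`. -/
abbrev TensorSpace (a : HomLieAction A B) (b : HomLieAction B A) : Type _ :=
  (M ⊗[K] N) ⧸ Submodule.span K {t | Relator a b t}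

variable (a : HomLieAction A B) (b : HomLieAction B A)

/-- The bilinear map `(m, n) ↦ m ⋆ n`. -/
def star : M →ₗ[K] N →ₗ[K] TensorSpace a b :=
  TensorProduct.curry (Submodule.mkQ (Submodule.span K {t | Relator a b t}))

variable {a b}

theorem mk_eq_star (m : M) (n : N) :
    (Submodule.Quotient.mk (m ⊗ₜ n) : TensorSpace a b) = star a b m n := rfl

/-- `M ⋆ N` is spanned by the symbols `m ⋆ n`. -/
theorem tensor_induction {P : TensorSpace a b → Prop} (h1 : ∀ m n, P (star a b m n))
    (h0 : P 0) (hadd : ∀ x y, P x → P y → P (x + y)) (x : TensorSpace a b) : P x := by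
  obtain ⟨t, rfl⟩ := Submodule.Quotient.mk_surjective _ x
  induction t using TensorProduct.induction_on with
  | zero => exact h0
  | tmul m n => exact h1 m n
  | add u v hu hv => rw [Submodule.Quotient.mk_add]; exact hadd _ _ hu hv

theorem mk_relator {t : M ⊗[K] N} (h : Relator a b t) :
    (Submodule.Quotient.mk t : TensorSpace a b) = 0 :=
  (Submodule.Quotient.mk_eq_zero _).2 (Submodule.subset_span h)

variable (a b)

theorem rel1 (m m' : M) (n : N) : star a b (A.bracket m m') (B.twist n) =
    star a b (A.twist m) (a.act m' n) - star a b (A.twist m') (a.act m n) := by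
  rw [← sub_eq_zero, ← mk_relator (Relator.r1 (a := a) (b := b) m m' n)]
  simp only [← mk_eq_star, ← Submodule.Quotient.mk_sub]

theorem rel2 (m : M) (n n' : N) : star a b (A.twist m) (B.bracket n n') =
    star a b (b.act n' m) (B.twist n) - star a b (b.act n m) (B.twist n') := by
  rw [← sub_eq_zero, ← mk_relator (Relator.r2 (a := a) (b := b) m n n')]
  simp only [← mk_eq_star, ← Submodule.Quotient.mk_sub]

theorem rel3 (m : M) (n : N) : star a b (b.act n m) (a.act m n) = 0 :=
  mk_relator (Relator.r3 (a := a) (b := b) m n)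

theorem rel4 (m m' : M) (n n' : N) : star a b (b.act n m) (a.act m' n') =
    -star a b (b.act n' m') (a.act m n) := by
  rw [eq_neg_iff_add_eq_zero, ← mk_relator (Relator.r4 (a := a) (b := b) m m' n n')]
  simp only [← mk_eq_star, ← Submodule.Quotient.mk_add]

variable {a b}

/-- `ψ₁(m ⋆ n) = -ⁿm`. -/
def psi1 (c : Compatible a b) : TensorSpace a b →ₗ[K] M :=
  Submodule.liftQ _ (TensorProduct.lift (-b.act.flip)) (Submodule.span_le.2 (by
    intro t ht
    simp only [SetLike.mem_coe, LinearMap.mem_ker]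
    cases ht with
    | r1 m m' n =>
      simp only [map_sub, TensorProduct.lift.tmul, LinearMap.neg_apply, LinearMap.flip_apply,
        c.m_act, b.act_apply_bracket, A.bracket_skew (A.twist m')]
      abel
    | r2 m n n' =>
      simp only [map_sub, TensorProduct.lift.tmul, LinearMap.neg_apply, LinearMap.flip_apply,
        b.act_bracket]
      abel
    | r3 m n => simp [c.m_act, A.bracket_self]
    | r4 m m' n n' =>
      simp only [map_add, TensorProduct.lift.tmul, LinearMap.neg_apply, LinearMap.flip_apply,
        c.m_act, A.bracket_skew (b.act n' m')]
      abel))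

/-- `ψ₂(m ⋆ n) = ᵐn`. -/
def psi2 (c : Compatible a b) : TensorSpace a b →ₗ[K] N :=
  Submodule.liftQ _ (TensorProduct.lift a.act) (Submodule.span_le.2 (by
    intro t ht
    simp only [SetLike.mem_coe, LinearMap.mem_ker]
    cases ht with
    | r1 m m' n => simp [a.act_bracket]
    | r2 m n n' =>
      simp only [map_sub, TensorProduct.lift.tmul, c.n_act, a.act_apply_bracket,
        B.bracket_skew (B.twist n')]
      abel
    | r3 m n => simp [c.n_act, B.bracket_self]
    | r4 m m' n n' =>
      simp only [map_add, TensorProduct.lift.tmul, c.n_act, B.bracket_skew (a.act m' n')]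
      abel))

@[simp] theorem psi1_star (c : Compatible a b) (m : M) (n : N) :
    psi1 c (star a b m n) = -b.act n m := by
  rw [← mk_eq_star]; simp [psi1]

@[simp] theorem psi2_star (c : Compatible a b) (m : M) (n : N) :
    psi2 c (star a b m n) = a.act m n := by
  rw [← mk_eq_star]; simp [psi2]

variable (a b) in
/-- The twisting map of `M ⋆ N`: `m ⋆ n ↦ α(m) ⋆ α(n)`. -/
def tensorTwist : TensorSpace a b →ₗ[K] TensorSpace a b :=
  Submodule.mapQ _ _ (TensorProduct.map A.twist B.twist) (Submodule.span_le.2 (by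
    intro t ht
    refine Submodule.subset_span ?_
    have e : ∀ {s : M ⊗[K] N}, Relator a b s → TensorProduct.map A.twist B.twist t = s →
        Relator a b (TensorProduct.map A.twist B.twist t) := fun h h' => h' ▸ h
    cases ht with
    | r1 m m' n => exact e (.r1 (A.twist m) (A.twist m') (B.twist n)) (by
        simp [A.twist_bracket, a.twist_act])
    | r2 m n n' => exact e (.r2 (A.twist m) (B.twist n) (B.twist n')) (by
        simp [B.twist_bracket, b.twist_act])
    | r3 m n => exact e (.r3 (A.twist m) (B.twist n)) (by simp [a.twist_act, b.twist_act])
    | r4 m m' n n' => exact e (.r4 (A.twist m) (A.twist m') (B.twist n) (B.twist n')) (by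
        simp [a.twist_act, b.twist_act])))

@[simp] theorem tensorTwist_star (m : M) (n : N) :
    tensorTwist a b (star a b m n) = star a b (A.twist m) (B.twist n) := by
  rw [← mk_eq_star, ← mk_eq_star]; simp [tensorTwist]

theorem psi1_tensorTwist (c : Compatible a b) (x : TensorSpace a b) :
    psi1 c (tensorTwist a b x) = A.twist (psi1 c x) := by
  induction x using tensor_induction with
  | h1 m n => simp [b.twist_act]
  | h0 => simp
  | hadd x y hx hy => simp [hx, hy]

theorem psi2_tensorTwist (c : Compatible a b) (x : TensorSpace a b) :
    psi2 c (tensorTwist a b x) = B.twist (psi2 c x) := by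
  induction x using tensor_induction with
  | h1 m n => simp [a.twist_act]
  | h0 => simp
  | hadd x y hx hy => simp [hx, hy]

theorem act_psi1 (c : Compatible a b) (x : TensorSpace a b) (n : N) :
    a.act (psi1 c x) n = B.bracket (psi2 c x) n := by
  induction x using tensor_induction with
  | h1 m n' => simp [c.n_act, B.bracket_skew n]
  | h0 => simp
  | hadd x y hx hy => simp [hx, hy]

theorem star_psi_skew (c : Compatible a b) (x y : TensorSpace a b) :
    star a b (psi1 c x) (psi2 c y) = -star a b (psi1 c y) (psi2 c x) := by
  induction x using tensor_induction with
  | h1 m n =>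
    induction y using tensor_induction with
    | h1 m' n' =>
      simp only [psi1_star, psi2_star, map_neg, LinearMap.neg_apply]
      rw [rel4 a b m m' n n']
    | h0 => simp
    | hadd x y hx hy =>
      simp only [map_add, LinearMap.add_apply, hx, hy]; abel
  | h0 => simp
  | hadd x y hx hy =>
    simp only [map_add, LinearMap.add_apply, hx, hy]; abel

theorem star_psi_self (c : Compatible a b) (x : TensorSpace a b) :
    star a b (psi1 c x) (psi2 c x) = 0 := by
  induction x using tensor_induction with
  | h1 m n => simp [rel3]
  | h0 => simp
  | hadd x y hx hy => simp [hx, hy, star_psi_skew c x y]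

theorem star_psi_leibniz (c : Compatible a b) (x y z : TensorSpace a b) :
    star a b (A.twist (psi1 c x)) (psi2 c (star a b (psi1 c y) (psi2 c z))) =
      star a b (psi1 c (star a b (psi1 c x) (psi2 c y))) (B.twist (psi2 c z)) -
      star a b (psi1 c (star a b (psi1 c x) (psi2 c z))) (B.twist (psi2 c y)) := by
  rw [psi2_star, act_psi1, rel2, psi1_star, psi1_star]
  simp only [map_neg, LinearMap.neg_apply]
  abel

/-- The non-abelian Hom-Lie tensor product `M ⋆ N`. Its bracket is `[x, y] = ψ₁(x) ⋆ ψ₂(y)`, that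
is `[m ⋆ n, m' ⋆ n'] = -(ⁿm ⋆ ᵐ'n')`; see `tensor_bracket` below. -/
def tensor (c : Compatible a b) : HomLieAlgebra K (TensorSpace a b) where
  bracket := (star a b).compl₁₂ (psi1 c) (psi2 c)
  twist := tensorTwist a b
  bracket_self x := by simpa using star_psi_self c x
  jacobi x y z := by
    simp only [LinearMap.compl₁₂_apply]
    rw [star_psi_skew c (tensorTwist a b z), star_psi_skew c (tensorTwist a b y),
      star_psi_skew c z x]
    simp only [psi1_tensorTwist, psi2_tensorTwist]
    rw [star_psi_leibniz]
    simp only [map_neg, LinearMap.neg_apply]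
    abel
  twist_bracket x y := by simp [psi1_tensorTwist, psi2_tensorTwist]

theorem tensor_bracket (c : Compatible a b) (m m' : M) (n n' : N) :
    (tensor c).bracket (star a b m n) (star a b m' n') =
      -star a b (b.act n m) (a.act m' n') := by
  simp [tensor]

end

end HomLieAction

/-! ### Tensor squares -/

namespace HomLeibnizAlgebra

variable {K L : Type*} [Field K] [AddCommGroup L] [Module K L] (A : HomLeibnizAlgebra K L)

theorem bracket_twist_swap (x y z : L) : A.bracket (A.twist x) (A.bracket y z) =
    -A.bracket (A.twist x) (A.bracket z y) := by
  rw [A.leibniz, A.leibniz]; abel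

/-- The action of a Hom-Leibniz algebra on itself by its bracket. -/
def selfAction : HomLeibnizAction A A where
  left := A.bracket
  right := A.bracket
  right_bracket := A.leibniz
  left_bracket m x y := by rw [A.leibniz]; abel
  left_left m x y := A.bracket_twist_swap x y m
  left_apply_bracket := A.leibniz
  right_apply_bracket x m m' := by rw [A.leibniz]; abel
  bracket_left x m m' := A.bracket_twist_swap m x m'
  twist_left := A.twist_bracket
  twist_right x m := A.twist_bracket m x

theorem selfAction_compatible : A.selfAction.Compatible A.selfAction := by
  constructor <;> intros <;> rfl

/-- The underlying vector space of the Hom-Leibniz tensor square `L ∗ L`. -/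
abbrev TensorSquareSpace : Type _ := HomLeibnizAction.TensorSpace A.selfAction A.selfAction

/-- The non-abelian Hom-Leibniz tensor square `L ∗ L`. -/
def tensorSquare : HomLeibnizAlgebra K A.TensorSquareSpace :=
  HomLeibnizAction.tensor A.selfAction_compatible

end HomLeibnizAlgebra

namespace HomLieAlgebra

variable {K L : Type*} [Field K] [AddCommGroup L] [Module K L] (A : HomLieAlgebra K L)

/-- The action of a Hom-Lie algebra on itself by its bracket. -/
def selfAction : HomLieAction A A where
  act := A.bracket
  act_bracket x y m := by
    have h := A.toHomLeibniz.leibniz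
    simp only [toHomLeibniz] at h
    rw [A.bracket_skew _ (A.twist m), h, A.bracket_skew (A.twist x), A.bracket_skew (A.twist y),
      A.bracket_skew m x, A.bracket_skew m y]
    simp only [map_neg, LinearMap.neg_apply]
    abel
  act_apply_bracket x m m' := by
    have h := A.toHomLeibniz.leibniz
    simp only [toHomLeibniz] at h
    rw [h, A.bracket_skew (A.twist m)]
    abel
  twist_act := A.twist_bracket

theorem selfAction_compatible : A.selfAction.Compatible A.selfAction := by
  constructor <;> intro m m' n <;> simp only [selfAction] <;>
    rw [A.bracket_skew m' (A.bracket n m), A.bracket_skew m n] <;> simp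

/-- The underlying vector space of the Hom-Lie tensor square `L ⋆ L`. -/
abbrev TensorSquareSpace : Type _ := HomLieAction.TensorSpace A.selfAction A.selfAction

/-- The non-abelian Hom-Lie tensor square `L ⋆ L`. -/
def tensorSquare : HomLieAlgebra K A.TensorSquareSpace :=
  HomLieAction.tensor A.selfAction_compatible

/-- The canonical map `ξ : L ∗ L → L ⋆ L`: on a symbol `m ∗ n` of the first kind it is `m ⋆ n`, on
a symbol `n ∗ m` of the second kind it is `-(m ⋆ n)`. -/
def tensorSquareMap : A.toHomLeibniz.TensorSquareSpace →ₗ[K] A.TensorSquareSpace :=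
  HomLeibnizAction.tensorLift _ _ (HomLieAction.star A.selfAction A.selfAction)
    (-(HomLieAction.star A.selfAction A.selfAction).flip) (by
      have s1 : ∀ m m' n : L, HomLieAction.star A.selfAction A.selfAction (A.bracket m m')
          (A.twist n) = HomLieAction.star A.selfAction A.selfAction (A.twist m) (A.bracket m' n) -
          HomLieAction.star A.selfAction A.selfAction (A.twist m') (A.bracket m n) :=
        HomLieAction.rel1 A.selfAction A.selfAction
      have s2 : ∀ m n n' : L, HomLieAction.star A.selfAction A.selfAction (A.twist m)
          (A.bracket n n') =
          HomLieAction.star A.selfAction A.selfAction (A.bracket n' m) (A.twist n) -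
          HomLieAction.star A.selfAction A.selfAction (A.bracket n m) (A.twist n') :=
        HomLieAction.rel2 A.selfAction A.selfAction
      have s4 : ∀ m m' n n' : L, HomLieAction.star A.selfAction A.selfAction (A.bracket n m)
          (A.bracket m' n') =
          -HomLieAction.star A.selfAction A.selfAction (A.bracket n' m') (A.bracket m n) :=
        HomLieAction.rel4 A.selfAction A.selfAction
      intro t ht
      cases ht with
      | r1 m n n' =>
        simp only [HomLeibnizAlgebra.selfAction, toHomLeibniz, LinearMap.coprod_apply, map_sub,
          map_zero, TensorProduct.lift.tmul, add_zero, s2 m n n']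
        rw [A.bracket_skew n' m, A.bracket_skew n m]
        simp only [map_neg, LinearMap.neg_apply]
        abel
      | r2 n m m' =>
        simp only [HomLeibnizAlgebra.selfAction, toHomLeibniz, LinearMap.coprod_apply, map_sub,
          map_zero, TensorProduct.lift.tmul, zero_add, LinearMap.neg_apply, LinearMap.flip_apply,
          s1 m m' n]
        rw [A.bracket_skew n m, A.bracket_skew n m']
        simp only [map_neg]
        abel
      | r3 m m' n =>
        simp only [HomLeibnizAlgebra.selfAction, toHomLeibniz, LinearMap.coprod_apply, map_sub,
          map_zero, TensorProduct.lift.tmul, zero_add, add_zero, LinearMap.neg_apply,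
          LinearMap.flip_apply, s1 m m' n]
        rw [A.bracket_skew n m']
        simp only [map_neg]
        abel
      | r4 n n' m =>
        simp only [HomLeibnizAlgebra.selfAction, toHomLeibniz, LinearMap.coprod_apply, map_sub,
          map_zero, TensorProduct.lift.tmul, zero_add, add_zero, LinearMap.neg_apply,
          LinearMap.flip_apply, s2 m n n']
        rw [A.bracket_skew m n']
        simp only [map_neg, LinearMap.neg_apply]
        abel
      | r5 m m' n =>
        simp only [HomLeibnizAlgebra.selfAction, toHomLeibniz, LinearMap.coprod_apply, map_sub,
          map_zero, TensorProduct.lift.tmul, add_zero, map_neg]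
        rw [A.bracket_skew n m']
        simp
      | r6 n n' m =>
        simp only [HomLeibnizAlgebra.selfAction, toHomLeibniz, LinearMap.coprod_apply, map_sub,
          map_zero, TensorProduct.lift.tmul, zero_add, map_neg, LinearMap.neg_apply,
          LinearMap.flip_apply]
        rw [A.bracket_skew n' m]
        simp
      | r7 m m' n n' | r8 m m' n n' | r9 m m' n n' | r10 m m' n n' =>
        have h := s4 m m' n n'
        rw [A.bracket_skew n m, A.bracket_skew n' m'] at h
        simp only [map_neg, LinearMap.neg_apply, neg_neg] at h
        simp only [HomLeibnizAlgebra.selfAction, toHomLeibniz, LinearMap.coprod_apply, map_sub,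
          map_zero, TensorProduct.lift.tmul, zero_add, add_zero, LinearMap.neg_apply,
          LinearMap.flip_apply, A.bracket_skew n m, A.bracket_skew n' m', map_neg]
        rw [← h]
        abel)

@[simp] theorem tensorSquareMap_starMN (m n : L) :
    A.tensorSquareMap (HomLeibnizAction.starMN _ _ m n) = HomLieAction.star _ _ m n := by
  simp [tensorSquareMap]

@[simp] theorem tensorSquareMap_starNM (m n : L) :
    A.tensorSquareMap (HomLeibnizAction.starNM _ _ n m) = -HomLieAction.star _ _ m n := by
  simp [tensorSquareMap]

end HomLieAlgebra

/-! ### Second homology with trivial coefficients -/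

/-- The exterior power `Λⁿ L`, as a type with its vector space structure. -/
def Wedge (K L : Type*) [Field K] [AddCommGroup L] [Module K L] (n : ℕ) : Type _ := ⋀[K]^n L

noncomputable instance (K L : Type*) [Field K] [AddCommGroup L] [Module K L] (n : ℕ) :
    AddCommGroup (Wedge K L n) := inferInstanceAs (AddCommGroup (⋀[K]^n L))

noncomputable instance (K L : Type*) [Field K] [AddCommGroup L] [Module K L] (n : ℕ) :
    Module K (Wedge K L n) := inferInstanceAs (Module K (⋀[K]^n L))

namespace Wedge

variable (K L : Type*) [Field K] [AddCommGroup L] [Module K L]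

/-- The universal alternating map `(x₁, …, xₙ) ↦ x₁ ∧ ⋯ ∧ xₙ`. -/
noncomputable def ι (n : ℕ) : L [⋀^Fin n]→ₗ[K] Wedge K L n := exteriorPower.ιMulti K n

variable {K L} {V : Type*} [AddCommGroup V] [Module K V] {n : ℕ}

/-- The linear map `x₁ ∧ ⋯ ∧ xₙ ↦ f (x₁, …, xₙ)` defined by an alternating map `f`. -/
noncomputable def lift (f : L [⋀^Fin n]→ₗ[K] V) : Wedge K L n →ₗ[K] V :=
  exteriorPower.alternatingMapLinearEquiv f

@[simp] theorem lift_ι (f : L [⋀^Fin n]→ₗ[K] V) (v : Fin n → L) : lift f (ι K L n v) = f v :=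
  exteriorPower.alternatingMapLinearEquiv_apply_ιMulti f v

theorem hom_ext {f g : Wedge K L n →ₗ[K] V} (h : ∀ v, f (ι K L n v) = g (ι K L n v)) : f = g :=
  exteriorPower.linearMap_ext (AlternatingMap.ext h)

end Wedge

namespace HomLeibnizAlgebra

variable {K L : Type*} [Field K] [AddCommGroup L] [Module K L] (A : HomLeibnizAlgebra K L)

/-- The differential `L ⊗ L → L`, `x₁ ⊗ x₂ ↦ -[x₁, x₂]`. -/
def d2 : L ⊗[K] L →ₗ[K] L := -TensorProduct.lift A.bracket

/-- The differential `L ⊗ L ⊗ L → L ⊗ L`,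
`x₁ ⊗ x₂ ⊗ x₃ ↦ -[x₁, x₂] ⊗ α(x₃) + [x₁, x₃] ⊗ α(x₂) + α(x₁) ⊗ [x₂, x₃]`. -/
def d3 : (L ⊗[K] L) ⊗[K] L →ₗ[K] L ⊗[K] L :=
  -TensorProduct.map (TensorProduct.lift A.bracket) A.twist
    + (TensorProduct.map (TensorProduct.lift A.bracket) A.twist).comp
        (TensorProduct.rightComm K L L L).toLinearMap
    + (TensorProduct.map A.twist (TensorProduct.lift A.bracket)).comp
        (TensorProduct.assoc K L L L).toLinearMap

@[simp] theorem d2_tmul (x y : L) : A.d2 (x ⊗ₜ y) = -A.bracket x y := by simp [d2]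

@[simp] theorem d3_tmul (x y z : L) : A.d3 (x ⊗ₜ y ⊗ₜ z) =
    -(A.bracket x y ⊗ₜ A.twist z) + A.bracket x z ⊗ₜ A.twist y
      + A.twist x ⊗ₜ A.bracket y z := by simp [d3]

theorem d2_comp_d3 : A.d2.comp A.d3 = 0 := by
  ext x y z
  simp [A.leibniz]
  abel

/-- The second homology `HL₂(L)` with coefficients in the trivial Hom-co-representation `(K, id)`:
the homology at `L ⊗ L` of the complex whose degree `n` term is `K ⊗ L^{⊗ n} = L^{⊗ n}`. -/
abbrev HL2 : Type _ := A.d2.ker ⧸ A.d3.range.submoduleOf A.d2.ker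

end HomLeibnizAlgebra

namespace HomLieAlgebra

variable {K L : Type*} [Field K] [AddCommGroup L] [Module K L] (A : HomLieAlgebra K L)

theorem update_zero {X : Type*} (x y z : X) : Function.update ![x, y] 0 z = ![z, y] := by
  ext i; fin_cases i <;> rfl

theorem update_one {X : Type*} (x y z : X) : Function.update ![x, y] 1 z = ![x, z] := by
  ext i; fin_cases i <;> rfl

variable (K L) in
/-- The bilinear map `(x, y) ↦ x ∧ y` to the second exterior power. -/
noncomputable def wedge : L →ₗ[K] L →ₗ[K] Wedge K L 2 :=
  LinearMap.mk₂ K (fun x y => Wedge.ι K L 2 ![x, y])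
    (fun x x' y => by
      have h := (Wedge.ι K L 2).map_update_add ![x, y] 0 x x'
      rwa [update_zero, update_zero, update_zero] at h)
    (fun r x y => by
      have h := (Wedge.ι K L 2).map_update_smul ![x, y] 0 r x
      rwa [update_zero, update_zero] at h)
    (fun x y y' => by
      have h := (Wedge.ι K L 2).map_update_add ![x, y] 1 y y'
      rwa [update_one, update_one, update_one] at h)
    (fun r x y => by
      have h := (Wedge.ι K L 2).map_update_smul ![x, y] 1 r y
      rwa [update_one, update_one] at h)

theorem wedge_self (x : L) : wedge K L x x = 0 :=
  (Wedge.ι K L 2).map_eq_zero_of_eq ![x, x] (i := 0) (j := 1) rfl (by decide)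

theorem wedge_skew (x y : L) : wedge K L x y = -wedge K L y x := by
  have h := wedge_self (K := K) (x + y)
  simp only [map_add, LinearMap.add_apply, wedge_self, zero_add, add_zero] at h
  refine eq_neg_of_add_eq_zero_left ?_
  first
    | exact h
    | (rw [add_comm]; exact h)

/-- The differential `Λ² L → L`, `x₁ ∧ x₂ ↦ -[x₁, x₂]`. -/
noncomputable def d2 : Wedge K L 2 →ₗ[K] L :=
  Wedge.lift
    { toFun := fun v => -A.bracket (v 0) (v 1)
      map_update_add' := by
        intro inst v i x y
        rw [Subsingleton.elim inst (instDecidableEqFin 2)]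
        fin_cases i <;> simp <;> abel
      map_update_smul' := by
        intro inst v i r x
        rw [Subsingleton.elim inst (instDecidableEqFin 2)]
        fin_cases i <;> simp
      map_eq_zero_of_eq' := by
        intro v i j h hij
        fin_cases i <;> fin_cases j <;> simp_all [A.bracket_self] }

theorem fin_three (i : Fin 3) : (i = 0 ∨ i = 1 ∨ i = 2) ∧ (0 : Fin 3) ≠ 1 ∧ (0 : Fin 3) ≠ 2 ∧
    (1 : Fin 3) ≠ 2 := by
  revert i; decide

/-- The differential `Λ³ L → Λ² L`,
`x₁ ∧ x₂ ∧ x₃ ↦ -[x₁, x₂] ∧ α(x₃) + [x₁, x₃] ∧ α(x₂) - [x₂, x₃] ∧ α(x₁)`. -/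
noncomputable def d3 : Wedge K L 3 →ₗ[K] Wedge K L 2 :=
  Wedge.lift
    { toFun := fun v =>
        -wedge K L (A.bracket (v 0) (v 1)) (A.twist (v 2))
          + wedge K L (A.bracket (v 0) (v 2)) (A.twist (v 1))
          - wedge K L (A.bracket (v 1) (v 2)) (A.twist (v 0))
      map_update_add' := by
        intro inst v i x y
        obtain ⟨hi, e01, e02, e12⟩ := fin_three i
        obtain rfl | rfl | rfl := hi
        all_goals simp only [Function.update_self, Function.update_of_ne e01,
          Function.update_of_ne e02, Function.update_of_ne e12,
          Function.update_of_ne e01.symm, Function.update_of_ne e02.symm,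
          Function.update_of_ne e12.symm]
        all_goals simp only [map_add, LinearMap.add_apply]
        all_goals abel
      map_update_smul' := by
        intro inst v i r x
        obtain ⟨hi, e01, e02, e12⟩ := fin_three i
        obtain rfl | rfl | rfl := hi
        all_goals simp only [Function.update_self, Function.update_of_ne e01,
          Function.update_of_ne e02, Function.update_of_ne e12,
          Function.update_of_ne e01.symm, Function.update_of_ne e02.symm,
          Function.update_of_ne e12.symm]
        all_goals simp only [map_smul, LinearMap.smul_apply, smul_add, smul_sub, smul_neg]
      map_eq_zero_of_eq' := by
        intro v i j h hij
        have h01 : ∀ x y : L, A.bracket x y = -A.bracket y x := A.bracket_skew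
        fin_cases i <;> fin_cases j <;> simp at hij h <;> (try simp only [h]) <;>
          simp [A.bracket_self, h01 (v 0) (v 1), h01 (v 0) (v 2), h01 (v 1) (v 2)]}

@[simp] theorem d2_wedge (x y : L) : A.d2 (wedge K L x y) = -A.bracket x y := by
  simp only [d2, wedge, LinearMap.mk₂_apply,
    Wedge.lift_ι]
  rfl

@[simp] theorem d3_wedge (x y z : L) : A.d3 (Wedge.ι K L 3 ![x, y, z]) =
    -wedge K L (A.bracket x y) (A.twist z) + wedge K L (A.bracket x z) (A.twist y)
      - wedge K L (A.bracket y z) (A.twist x) := by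
  simp only [d3, Wedge.lift_ι]
  rfl

theorem d2_comp_d3 : A.d2.comp A.d3 = 0 := by
  refine Wedge.hom_ext fun v => ?_
  obtain ⟨x, y, z, rfl⟩ : ∃ x y z, v = ![x, y, z] :=
    ⟨v 0, v 1, v 2, by ext i; fin_cases i <;> rfl⟩
  have h := A.toHomLeibniz.leibniz x y z
  simp only [toHomLeibniz] at h
  simp only [LinearMap.comp_apply, d3_wedge, map_add, map_sub,
    map_neg, d2_wedge, A.bracket_skew (A.bracket y z), h, LinearMap.zero_apply]
  abel

/-- The second homology `H₂(L)` with trivial coefficients: the homology at `Λ² L` of the complex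
whose degree `n` term is `K ⊗ Λⁿ L = Λⁿ L`. -/
abbrev H2 : Type _ := A.d2.ker ⧸ A.d3.range.submoduleOf A.d2.ker

variable (K L) in
/-- The projection `L ⊗ L → Λ² L`, `x ⊗ y ↦ x ∧ y`. -/
noncomputable def tensorToWedge : L ⊗[K] L →ₗ[K] Wedge K L 2 := TensorProduct.lift (wedge K L)

theorem d2_tensorToWedge (t : L ⊗[K] L) :
    A.d2 (tensorToWedge K L t) = A.toHomLeibniz.d2 t := by
  induction t using TensorProduct.induction_on with
  | zero => simp
  | tmul x y => simp [tensorToWedge, toHomLeibniz]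
  | add x y hx hy => simp [hx, hy]

theorem tensorToWedge_d3_mem (t : (L ⊗[K] L) ⊗[K] L) :
    tensorToWedge K L (A.toHomLeibniz.d3 t) ∈ A.d3.range := by
  induction t using TensorProduct.induction_on with
  | zero => simp
  | add x y hx hy => rw [map_add, map_add]; exact add_mem hx hy
  | tmul s z =>
    induction s using TensorProduct.induction_on with
    | zero => simp
    | add x y hx hy => rw [TensorProduct.add_tmul, map_add, map_add]; exact add_mem hx hy
    | tmul x y =>
      refine ⟨Wedge.ι K L 3 ![x, y, z], ?_⟩
      simp [tensorToWedge, toHomLeibniz, wedge_skew (A.twist x), sub_eq_add_neg]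

/-- The canonical map `HL₂(L) → H₂(L)` induced by `x ⊗ y ↦ x ∧ y`. -/
noncomputable def homologyMap : A.toHomLeibniz.HL2 →ₗ[K] A.H2 :=
  Submodule.mapQ _ _
    ((tensorToWedge K L).restrict (p := A.toHomLeibniz.d2.ker) (q := A.d2.ker) (by
      intro t ht
      rw [LinearMap.mem_ker] at ht ⊢
      rw [d2_tensorToWedge, ht]))
    (by
      rintro ⟨t, ht⟩ ⟨s, hs⟩
      change tensorToWedge K L t ∈ A.d3.range
      have hs' : A.toHomLeibniz.d3 s = t := hs
      rw [← hs']
      exact A.tensorToWedge_d3_mem s)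

end HomLieAlgebra

/-! Every condition in the statement turns out to be equivalent to one equation: `x ∗ x = 0` in `L ∗
L` for all `x`, where `∗` denotes symbols of the first family.

On the homological side, the first family of symbols embeds `L ⊗ L / im d₃` into `L ∗ L`, so the
equation says that every `x ⊗ x` lies in `im d₃` (`starMN_self_iff_mem_range_d3`). Each `x ⊗ x` is a
cycle with zero image in `Λ² L`, so injectivity of `π` forces this. Conversely, if all squares are
boundaries, the class map `L ⊗ L → L ⊗ L / im d₃` is alternating and factors through `Λ² L`, which
makes `π` injective (`homologyMap_injective_iff`). Surjectivity of `π` is automatic.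

On the tensor side, both brackets have the form `[u, v] = ψ₁(u) ∗ ψ₂(v)` with `ψ₁ = ψ₂`, and
perfectness makes this map onto `L`. Hence `x ∗ x` is always some `[u, u]`. These squares vanish in
the Hom-Lie algebra `L ⋆ L`, and therefore in `L ∗ L` as soon as the two are isomorphic in any way
at all (`IsPerfect.starMN_self_of_isomorphic`). Conversely, if `x ∗ x = 0` for all `x`, then `m ⋆ n
↦ m ∗ n` respects the relations of `L ⋆ L` and inverts `ξ`, because perfectness also identifies the
two families of symbols (`IsPerfect.tensorSquareMap_injective`). -/

namespace HomLeibnizAlgebra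

variable {K L : Type*} [Field K] [AddCommGroup L] [Module K L] (A : HomLeibnizAlgebra K L)

/-! ### Diagonal symbols `x ∗ x` and the image of `d₃`. -/

theorem psi1_starMN (x y : L) :
    HomLeibnizAction.psi1 A.selfAction_compatible (HomLeibnizAction.starMN _ _ x y) =
      A.bracket x y :=
  HomLeibnizAction.tensorLift_starMN _ _ _ x y

theorem psi1_starNM (x y : L) :
    HomLeibnizAction.psi1 A.selfAction_compatible (HomLeibnizAction.starNM _ _ x y) =
      A.bracket x y :=
  HomLeibnizAction.tensorLift_starNM _ _ _ y x

/-- The map `L ⊗ L / im d₃ → L ∗ L` given by the first family of symbols has a retraction, so it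
detects exactly which tensors are boundaries. Perfectness plays no role here. -/
theorem starMN_self_iff_mem_range_d3 :
    (∀ x : L, HomLeibnizAction.starMN A.selfAction A.selfAction
      x x = 0) ↔ ∀ x : L, x ⊗ₜ[K] x ∈ A.d3.range := by
  constructor
  · intro h x
    let q : L →ₗ[K] L →ₗ[K] (L ⊗[K] L) ⧸ A.d3.range :=
      TensorProduct.curry (Submodule.mkQ _)
    have rel : ∀ x y z, q (A.twist x) (A.bracket y z) =
        q (A.bracket x y) (A.twist z) - q (A.bracket x z) (A.twist y) := fun x y z => by
      have h' := (Submodule.Quotient.mk_eq_zero A.d3.range).2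
        ⟨x ⊗ₜ y ⊗ₜ z, rfl⟩
      rw [HomLeibnizAlgebra.d3_tmul, Submodule.Quotient.mk_add, Submodule.Quotient.mk_add,
        Submodule.Quotient.mk_neg] at h'
      change -q (A.bracket x y) (A.twist z) + q (A.bracket x z) (A.twist y) +
        q (A.twist x) (A.bracket y z) = 0 at h'
      rw [← sub_eq_zero, ← h']
      abel
    -- The retraction sends both families to the same class. The relators `r7` to `r10` then become
    -- tautologies, and `r1` to `r6` follow from `rel`.
    let θ : A.TensorSquareSpace →ₗ[K] (L ⊗[K] L) ⧸ A.d3.range :=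
      HomLeibnizAction.tensorLift _ _ q q (by
        intro t ht
        cases ht <;>
          simp only [HomLeibnizAlgebra.selfAction, LinearMap.coprod_apply, map_sub,
            map_neg, map_zero, TensorProduct.lift.tmul, add_zero, zero_add, rel] <;>
          abel)
    have hθ : θ (HomLeibnizAction.starMN _ _ x x) = q x x := by simp [θ]
    rw [h, map_zero] at hθ
    exact (Submodule.Quotient.mk_eq_zero _).1 hθ.symm
  · intro h x
    -- The first defining relation of `L ∗ L` is precisely the vanishing of the image of `d₃`.
    have hle : A.d3.range ≤ LinearMap.ker (TensorProduct.lift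
        (HomLeibnizAction.starMN A.selfAction A.selfAction)) := by
      rw [LinearMap.range_le_ker_iff]
      ext x y z
      have rel : HomLeibnizAction.starMN A.selfAction A.selfAction (A.twist x) (A.bracket y z) =
          HomLeibnizAction.starMN A.selfAction A.selfAction (A.bracket x y) (A.twist z) -
          HomLeibnizAction.starMN A.selfAction A.selfAction (A.bracket x z) (A.twist y) :=
        HomLeibnizAction.rel1 A.selfAction A.selfAction x y z
      change TensorProduct.lift (HomLeibnizAction.starMN A.selfAction A.selfAction)
        (A.d3 (x ⊗ₜ[K] y ⊗ₜ[K] z)) = 0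
      rw [d3_tmul, map_add, map_add, map_neg]
      simp only [TensorProduct.lift.tmul]
      rw [rel]
      abel
    simpa using hle (h x)

end HomLeibnizAlgebra

namespace HomLieAlgebra

variable {K L : Type*} [Field K] [AddCommGroup L] [Module K L] {A : HomLieAlgebra K L}

/-! ### Perfectness and the symbols of the two tensor squares. -/

theorem IsPerfect.mem_of_bracket_mem (hA : A.IsPerfect) (S : Submodule K L)
    (h : ∀ x y, A.bracket x y ∈ S) (z : L) : z ∈ S := by
  have hS : Submodule.span K {z : L | ∃ x y, z = A.bracket x y} ≤ S := by
    rw [Submodule.span_le]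
    rintro _ ⟨x, y, rfl⟩
    exact h x y
  rw [hA] at hS
  exact hS trivial

theorem IsPerfect.linearMap_ext {V : Type*} [AddCommGroup V] [Module K V] (hA : A.IsPerfect)
    {f g : L →ₗ[K] V} (h : ∀ x y, f (A.bracket x y) = g (A.bracket x y)) : f = g :=
  LinearMap.ext fun z => hA.mem_of_bracket_mem (LinearMap.eqLocus f g) h z

variable (A) in
theorem starMN_bracket_bracket (x y z w : L) :
    HomLeibnizAction.starMN A.toHomLeibniz.selfAction A.toHomLeibniz.selfAction
        (A.bracket x y) (A.bracket z w) =
      HomLeibnizAction.starNM A.toHomLeibniz.selfAction A.toHomLeibniz.selfAction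
        (A.bracket x y) (A.bracket z w) := by
  have h := (Submodule.Quotient.mk_eq_zero (Submodule.span K
    {t | HomLeibnizAction.Relator A.toHomLeibniz.selfAction A.toHomLeibniz.selfAction t})).2
    -- Every action is the bracket, so `r7` compares one pair of brackets in the two families. Its
    -- arguments are ordered `m m' n n'`, hence the interleaving.
    (Submodule.subset_span (HomLeibnizAction.Relator.r7 x z y w))
  rw [Submodule.Quotient.mk_sub, sub_eq_zero] at h
  exact h

/-- For a perfect Hom-Lie algebra the two families of symbols in `L ∗ L` coincide. -/
theorem IsPerfect.starMN_eq_starNM (hA : A.IsPerfect) :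
    HomLeibnizAction.starMN A.toHomLeibniz.selfAction A.toHomLeibniz.selfAction =
      HomLeibnizAction.starNM A.toHomLeibniz.selfAction A.toHomLeibniz.selfAction :=
  hA.linearMap_ext fun x y => hA.linearMap_ext fun z w => A.starMN_bracket_bracket x y z w

/-- The left and right self-actions are both the bracket, so the two maps are the same lift by
definition. -/
theorem psi1_eq_psi2 (x : A.toHomLeibniz.TensorSquareSpace) :
    HomLeibnizAction.psi1 A.toHomLeibniz.selfAction_compatible x =
      HomLeibnizAction.psi2 A.toHomLeibniz.selfAction_compatible x := rfl

theorem IsPerfect.psi1_surjective (hA : A.IsPerfect) :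
    Function.Surjective (HomLeibnizAction.psi1 A.toHomLeibniz.selfAction_compatible) :=
  hA.mem_of_bracket_mem
    (LinearMap.range (HomLeibnizAction.psi1 A.toHomLeibniz.selfAction_compatible)) fun x y =>
    ⟨HomLeibnizAction.starMN _ _ x y, A.toHomLeibniz.psi1_starMN x y⟩

/-- On symbols this is `-[n, m] = [m, n]`. -/
theorem lie_psi1_eq_psi2 (x : A.TensorSquareSpace) :
    HomLieAction.psi1 A.selfAction_compatible x = HomLieAction.psi2 A.selfAction_compatible x := by
  induction x using HomLieAction.tensor_induction with
  | h1 m n =>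
    rw [HomLieAction.psi1_star, HomLieAction.psi2_star]
    exact (A.bracket_skew m n).symm
  | h0 => simp
  | hadd x y hx hy => simp [hx, hy]

theorem IsPerfect.lie_psi2_surjective (hA : A.IsPerfect) :
    Function.Surjective (HomLieAction.psi2 A.selfAction_compatible) :=
  hA.mem_of_bracket_mem (LinearMap.range (HomLieAction.psi2 A.selfAction_compatible)) fun x y =>
    ⟨HomLieAction.star _ _ x y, HomLieAction.psi2_star _ x y⟩

/-- Writing `x = ψ₂(z)` turns `x ⋆ x` into the bracket `[z, z]` of a Hom-Lie algebra. -/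
theorem IsPerfect.star_self (hA : A.IsPerfect) (x : L) :
    HomLieAction.star A.selfAction A.selfAction x x = 0 := by
  obtain ⟨z, rfl⟩ := hA.lie_psi2_surjective x
  have h := HomLieAction.star_psi_self A.selfAction_compatible z
  rwa [lie_psi1_eq_psi2] at h

/-! ### The canonical epimorphism `ξ` and its injectivity. -/

variable (A) in
theorem tensorSquareMap_surjective : Function.Surjective A.tensorSquareMap := by
  intro x
  induction x using HomLieAction.tensor_induction with
  | h1 m n => exact ⟨_, A.tensorSquareMap_starMN m n⟩
  | h0 => exact ⟨0, map_zero _⟩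
  | hadd x y hx hy =>
    obtain ⟨u, rfl⟩ := hx
    obtain ⟨v, rfl⟩ := hy
    exact ⟨u + v, map_add _ _ _⟩

theorem psi_tensorSquareMap (x : A.toHomLeibniz.TensorSquareSpace) :
    HomLieAction.psi2 A.selfAction_compatible (A.tensorSquareMap x) =
      HomLeibnizAction.psi1 A.toHomLeibniz.selfAction_compatible x := by
  induction x using HomLeibnizAction.tensor_induction with
  | h1 m n =>
    rw [tensorSquareMap_starMN, HomLieAction.psi2_star, HomLeibnizAlgebra.psi1_starMN]
    rfl
  | h2 n m =>
    rw [tensorSquareMap_starNM, map_neg, HomLieAction.psi2_star, HomLeibnizAlgebra.psi1_starNM]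
    exact (A.bracket_skew n m).symm
  | h0 => simp
  | hadd x y hx hy => simp [hx, hy]

variable (A) in
-- Both brackets are the symbol of the `ψ`-images of their arguments, and `ξ` preserves these
-- images.
theorem tensorSquareMap_bracket (x y : A.toHomLeibniz.TensorSquareSpace) :
    A.tensorSquareMap (A.toHomLeibniz.tensorSquare.bracket x y) =
      A.tensorSquare.bracket (A.tensorSquareMap x) (A.tensorSquareMap y) := by
  simp only [HomLeibnizAlgebra.tensorSquare, HomLeibnizAction.tensor, tensorSquare,
    HomLieAction.tensor, LinearMap.compl₁₂_apply, tensorSquareMap_starMN, lie_psi1_eq_psi2,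
    psi_tensorSquareMap, psi1_eq_psi2]

variable (A) in
theorem tensorSquareMap_twist (x : A.toHomLeibniz.TensorSquareSpace) :
    A.tensorSquareMap (A.toHomLeibniz.tensorSquare.twist x) =
      A.tensorSquare.twist (A.tensorSquareMap x) := by
  change A.tensorSquareMap (HomLeibnizAction.tensorTwist _ _ x) =
    HomLieAction.tensorTwist _ _ (A.tensorSquareMap x)
  induction x using HomLeibnizAction.tensor_induction with
  | h1 m n =>
    rw [HomLeibnizAction.tensorTwist_starMN, tensorSquareMap_starMN, tensorSquareMap_starMN,
      HomLieAction.tensorTwist_star]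
    rfl
  | h2 n m =>
    rw [HomLeibnizAction.tensorTwist_starNM, tensorSquareMap_starNM, tensorSquareMap_starNM,
      map_neg, HomLieAction.tensorTwist_star]
    rfl
  | h0 => simp
  | hadd x y hx hy => simp [hx, hy]

theorem isomorphic_of_bijective_tensorSquareMap (h : Function.Bijective A.tensorSquareMap) :
    A.tensorSquare.toHomLeibniz.Isomorphic A.toHomLeibniz.tensorSquare := by
  let e := LinearEquiv.ofBijective A.tensorSquareMap h
  refine ⟨e.symm, fun x y => ?_, fun x => ?_⟩
  · obtain ⟨u, rfl⟩ := e.surjective x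
    obtain ⟨v, rfl⟩ := e.surjective y
    rw [e.symm_apply_eq, e.symm_apply_apply, e.symm_apply_apply]
    exact (A.tensorSquareMap_bracket u v).symm
  · obtain ⟨u, rfl⟩ := e.surjective x
    rw [e.symm_apply_eq, e.symm_apply_apply]
    exact (A.tensorSquareMap_twist u).symm

/-- An arbitrary isomorphism suffices, since the identity `[w, w] = 0` is transported by any map
preserving brackets. -/
theorem IsPerfect.starMN_self_of_isomorphic (hA : A.IsPerfect)
    (h : A.tensorSquare.toHomLeibniz.Isomorphic A.toHomLeibniz.tensorSquare) (x : L) :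
    HomLeibnizAction.starMN A.toHomLeibniz.selfAction A.toHomLeibniz.selfAction x x = 0 := by
  obtain ⟨e, he, -⟩ := h
  obtain ⟨z, rfl⟩ := hA.psi1_surjective x
  obtain ⟨w, rfl⟩ := e.surjective z
  have h1 := he w w
  rw [show A.tensorSquare.toHomLeibniz.bracket w w = 0 from A.tensorSquare.bracket_self w,
    map_zero] at h1
  -- By definition `[e w, e w]` is `ψ₁(e w) ∗ ψ₂(e w)`, and `ψ₂ = ψ₁` definitionally.
  exact h1.symm

theorem IsPerfect.starMN_self_of_injective (hA : A.IsPerfect)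
    (h : Function.Injective A.tensorSquareMap) (x : L) :
    HomLeibnizAction.starMN A.toHomLeibniz.selfAction A.toHomLeibniz.selfAction x x = 0 :=
  h (by rw [tensorSquareMap_starMN, hA.star_self, map_zero])

theorem IsPerfect.tensorSquareMap_injective (hA : A.IsPerfect)
    (h : ∀ x : L, HomLeibnizAction.starMN A.toHomLeibniz.selfAction A.toHomLeibniz.selfAction
      x x = 0) : Function.Injective A.tensorSquareMap := by
  set s := HomLeibnizAction.starMN A.toHomLeibniz.selfAction A.toHomLeibniz.selfAction with hs
  have skew : ∀ x y, s x y = -s y x := fun x y => by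
    have h' := h (x + y)
    simp only [map_add, LinearMap.add_apply, h, zero_add, add_zero] at h'
    rw [eq_neg_iff_add_eq_zero, add_comm]
    exact h'
  have rel : ∀ x y z, s (A.twist x) (A.bracket y z) =
      s (A.bracket x y) (A.twist z) - s (A.bracket x z) (A.twist y) :=
    HomLeibnizAction.rel1 A.toHomLeibniz.selfAction A.toHomLeibniz.selfAction
  -- The candidate inverse `m ⋆ n ↦ m ∗ n`. Skew-symmetry reduces both Hom-Lie expansion relations
  -- to the single relation `rel`.
  let η : A.TensorSquareSpace →ₗ[K] A.toHomLeibniz.TensorSquareSpace :=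
    Submodule.liftQ _ (TensorProduct.lift s) (Submodule.span_le.2 (by
      intro t ht
      simp only [SetLike.mem_coe, LinearMap.mem_ker]
      cases ht with
      | r1 m m' n =>
        simp only [selfAction, map_sub, TensorProduct.lift.tmul]
        rw [skew (A.bracket m m'), rel n m m', skew (A.twist m), skew (A.twist m'),
          A.bracket_skew n m, A.bracket_skew n m']
        simp only [map_neg, LinearMap.neg_apply]
        abel
      | r2 m n n' =>
        simp only [selfAction, map_sub, TensorProduct.lift.tmul]
        rw [rel, A.bracket_skew n' m, A.bracket_skew n m]
        simp only [map_neg, LinearMap.neg_apply]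
        abel
      -- Here `x ∗ x = 0` itself is needed; skew-symmetry would not be enough in characteristic two.
      | r3 m n =>
        simp only [selfAction, TensorProduct.lift.tmul]
        rw [A.bracket_skew n m, map_neg, LinearMap.neg_apply, h, neg_zero]
      | r4 m m' n n' =>
        simp only [selfAction, map_add, TensorProduct.lift.tmul]
        rw [skew (A.bracket n' m'), A.bracket_skew n m, A.bracket_skew n' m']
        simp only [map_neg, LinearMap.neg_apply]
        abel))
  have hη : ∀ m n, η (HomLieAction.star _ _ m n) = s m n := fun m n => by
    rw [← HomLieAction.mk_eq_star]
    simp [η]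
  refine Function.LeftInverse.injective (g := η) fun x => ?_
  induction x using HomLeibnizAction.tensor_induction with
  | h1 m n => rw [tensorSquareMap_starMN, hη]
  | h2 n m =>
    -- The composite sends a second-family symbol to the first-family symbol with the same entries;
    -- perfectness identifies the two.
    rw [tensorSquareMap_starNM, map_neg, hη, ← skew, hs, hA.starMN_eq_starNM]
  | h0 => simp
  | hadd x y hx hy => rw [map_add, map_add, hx, hy]

/-! ### The canonical map `π` in homology. -/

theorem tensorToWedge_surjective : Function.Surjective (tensorToWedge K L) := by
  have h : (LinearMap.range (tensorToWedge K L)).mkQ = 0 := by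
    refine Wedge.hom_ext fun v => ?_
    rw [LinearMap.zero_apply, Submodule.mkQ_apply, Submodule.Quotient.mk_eq_zero]
    refine ⟨v 0 ⊗ₜ v 1, ?_⟩
    simp only [tensorToWedge, TensorProduct.lift.tmul, wedge, LinearMap.mk₂_apply]
    congr 1
    ext i; fin_cases i <;> rfl
  intro x
  exact (Submodule.Quotient.mk_eq_zero _).1 (LinearMap.congr_fun h x)

variable (A) in
-- The two `d₂` agree along `L ⊗ L → Λ² L`, so any tensor lifting a cycle is again a cycle.
theorem homologyMap_surjective : Function.Surjective A.homologyMap := by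
  intro y
  obtain ⟨⟨w, hw⟩, rfl⟩ := Submodule.Quotient.mk_surjective _ y
  obtain ⟨t, rfl⟩ := tensorToWedge_surjective w
  refine ⟨Submodule.Quotient.mk ⟨t, ?_⟩, rfl⟩
  rw [LinearMap.mem_ker] at hw ⊢
  rw [← d2_tensorToWedge, hw]

variable (A) in
theorem homologyMap_injective_iff :
    Function.Injective A.homologyMap ↔ ∀ x : L, x ⊗ₜ[K] x ∈ A.toHomLeibniz.d3.range := by
  constructor
  · intro h x
    have hx : x ⊗ₜ[K] x ∈ A.toHomLeibniz.d2.ker := by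
      simp [toHomLeibniz, A.bracket_self]
    have h0 : A.homologyMap (Submodule.Quotient.mk ⟨x ⊗ₜ x, hx⟩) = 0 := by
      refine (Submodule.Quotient.mk_eq_zero _).2 ?_
      change tensorToWedge K L (x ⊗ₜ x) ∈ A.d3.range
      simp [tensorToWedge, wedge_self]
    exact (Submodule.Quotient.mk_eq_zero (A.toHomLeibniz.d3.range.submoduleOf
      A.toHomLeibniz.d2.ker)).1 (h (h0.trans (map_zero _).symm))
  · intro h
    let q : L →ₗ[K] L →ₗ[K] (L ⊗[K] L) ⧸ A.toHomLeibniz.d3.range :=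
      TensorProduct.curry (Submodule.mkQ _)
    have q_self : ∀ x, q x x = 0 := fun x => (Submodule.Quotient.mk_eq_zero _).2 (h x)
    have skew : ∀ x y, q x y = -q y x := fun x y => by
      have h' := q_self (x + y)
      simp only [map_add, LinearMap.add_apply, q_self, zero_add, add_zero] at h'
      rw [eq_neg_iff_add_eq_zero, add_comm]
      exact h'
    have rel : ∀ x y z, -q (A.bracket x y) (A.twist z) + q (A.bracket x z) (A.twist y) +
        q (A.twist x) (A.bracket y z) = 0 := fun x y z => by
      have h' := (Submodule.Quotient.mk_eq_zero A.toHomLeibniz.d3.range).2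
        ⟨x ⊗ₜ y ⊗ₜ z, rfl⟩
      rwa [HomLeibnizAlgebra.d3_tmul, Submodule.Quotient.mk_add, Submodule.Quotient.mk_add,
        Submodule.Quotient.mk_neg] at h'
    -- Since squares are boundaries, the class map is alternating and descends to `Λ² L`.
    let ρ : Wedge K L 2 →ₗ[K] (L ⊗[K] L) ⧸ A.toHomLeibniz.d3.range := Wedge.lift
      { toFun := fun v => q (v 0) (v 1)
        map_update_add' := by
          intro inst v i x y
          rw [Subsingleton.elim inst (instDecidableEqFin 2)]
          fin_cases i <;> simp
        map_update_smul' := by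
          intro inst v i r x
          rw [Subsingleton.elim inst (instDecidableEqFin 2)]
          fin_cases i <;> simp
        map_eq_zero_of_eq' := by
          intro v i j hv hij
          have h01 : v 0 = v 1 := by
            fin_cases i <;> fin_cases j <;>
              first | exact absurd rfl hij | exact hv | exact hv.symm
          rw [h01, q_self] }
    have hρ : ∀ x y, ρ (wedge K L x y) = q x y := fun x y => by
      simp only [ρ, wedge, LinearMap.mk₂_apply, Wedge.lift_ι]
      rfl
    have hρ_mk : ρ.comp (tensorToWedge K L) = Submodule.mkQ _ := by
      ext x y
      exact hρ x y
    -- The last term of the exterior differential has its factors in the opposite order, so one use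
    -- of `skew` turns the sum into `rel`.
    have hρ_d3 : ρ.comp A.d3 = 0 := by
      refine Wedge.hom_ext fun v => ?_
      obtain ⟨x, y, z, rfl⟩ : ∃ x y z, v = ![x, y, z] :=
        ⟨v 0, v 1, v 2, by ext i; fin_cases i <;> rfl⟩
      rw [LinearMap.comp_apply, d3_wedge, map_sub, map_add, map_neg, hρ, hρ, hρ,
        skew (A.bracket y z), sub_neg_eq_add, rel, LinearMap.zero_apply]
    rw [injective_iff_map_eq_zero]
    intro y hy
    obtain ⟨⟨t, ht⟩, rfl⟩ := Submodule.Quotient.mk_surjective _ y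
    obtain ⟨w, hw⟩ : tensorToWedge K L t ∈ A.d3.range :=
      (Submodule.Quotient.mk_eq_zero (A.d3.range.submoduleOf A.d2.ker)).1 hy
    refine (Submodule.Quotient.mk_eq_zero _).2 ?_
    change t ∈ A.toHomLeibniz.d3.range
    -- The class of `t` is `ρ` of its wedge image, which is `ρ (d₃ w) = 0`.
    rw [← Submodule.Quotient.mk_eq_zero, ← Submodule.mkQ_apply, ← hρ_mk, LinearMap.comp_apply,
      ← hw, ← LinearMap.comp_apply, hρ_d3, LinearMap.zero_apply]

/-! ### Combining the criteria. -/

variable (A) in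
theorem homologyMap_bijective_iff_starMN_self :
    Function.Bijective A.homologyMap ↔
      ∀ x : L, HomLeibnizAction.starMN A.toHomLeibniz.selfAction A.toHomLeibniz.selfAction
        x x = 0 := by
  rw [HomLeibnizAlgebra.starMN_self_iff_mem_range_d3, ← homologyMap_injective_iff]
  exact ⟨fun h => h.1, fun h => ⟨h, A.homologyMap_surjective⟩⟩

theorem IsPerfect.tensorSquareMap_bijective_iff (hA : A.IsPerfect) :
    Function.Bijective A.tensorSquareMap ↔ Function.Bijective A.homologyMap := by
  rw [homologyMap_bijective_iff_starMN_self]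
  exact ⟨fun h => hA.starMN_self_of_injective h.1,
    fun h => ⟨hA.tensorSquareMap_injective h, A.tensorSquareMap_surjective⟩⟩

theorem IsPerfect.isomorphic_iff (hA : A.IsPerfect) :
    A.tensorSquare.toHomLeibniz.Isomorphic A.toHomLeibniz.tensorSquare ↔
      Function.Bijective A.homologyMap :=
  ⟨fun h => A.homologyMap_bijective_iff_starMN_self.2 (hA.starMN_self_of_isomorphic h),
    fun h => isomorphic_of_bijective_tensorSquareMap (hA.tensorSquareMap_bijective_iff.2 h)⟩

variable (A) in
-- Composing the surjection `π` with any isomorphism `H₂ ≃ HL₂` gives a surjective endomorphism of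
-- the finite-dimensional space `H₂`, which must be injective.
theorem homologyMap_bijective_iff_nonempty_equiv [FiniteDimensional K A.H2] :
    Function.Bijective A.homologyMap ↔ Nonempty (A.H2 ≃ₗ[K] A.toHomLeibniz.HL2) := by
  refine ⟨fun h => ⟨(LinearEquiv.ofBijective A.homologyMap h).symm⟩, fun ⟨e⟩ => ?_⟩
  have hs : Function.Surjective (A.homologyMap.comp e.toLinearMap) :=
    A.homologyMap_surjective.comp e.surjective
  refine ⟨fun x y hxy => ?_, A.homologyMap_surjective⟩
  have hi := LinearMap.injective_iff_surjective.2 hs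
  exact e.symm.injective (hi (by simpa using hxy))

end HomLieAlgebra

/-- For a perfect Hom-Lie algebra `L`: the tensor squares `L ⋆ L` and `L ∗ L` are isomorphic as
Hom-Leibniz algebras iff the canonical map `HL₂(L) → H₂(L)` is an isomorphism; this holds iff the
canonical map `L ∗ L → L ⋆ L` is an isomorphism; and when `H₂(L)` is finite-dimensional it holds
iff there is any linear isomorphism `H₂(L) ≃ HL₂(L)`. -/
theorem proposition4p7 {K L : Type*} [Field K] [AddCommGroup L] [Module K L]
    (A : HomLieAlgebra K L) (hA : A.IsPerfect) :
    (A.tensorSquare.toHomLeibniz.Isomorphic A.toHomLeibniz.tensorSquare ↔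
      Function.Bijective A.homologyMap) ∧
    (Function.Bijective A.tensorSquareMap ↔ Function.Bijective A.homologyMap) ∧
    (FiniteDimensional K A.H2 →
      (A.tensorSquare.toHomLeibniz.Isomorphic A.toHomLeibniz.tensorSquare ↔
        Nonempty (A.H2 ≃ₗ[K] A.toHomLeibniz.HL2))) := by
  exact ⟨hA.isomorphic_iff, hA.tensorSquareMap_bijective_iff, fun _ =>
    hA.isomorphic_iff.trans A.homologyMap_bijective_iff_nonempty_equiv⟩
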